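/- Let $n\ge 1$ be an integer. For $m\ge 0$, a matching on $[2m]=\{1,2,\dots,2m\}$ is a set partition of $[2m]$ into two-element blocks, called edges; $\mathcal M(m)$ denotes the set of these matchings. Two edges $A,B$ of a matching form a nesting if $\min A<\min B<\max B<\max A$ or $\min B<\min A<\max A<\max B$, and $ne(M)$ is the number of nestings (unordered pairs of edges) in $M$. A child of $M\in\mathcal M(m)$ is a matching in $\mathcal M(m+1)$ obtained by choosing $x\in\{2,\dots,2m+2\}$, relabelling the vertices of $M$, in the same order, as $\{2,\dots,2m+2\}\setminus\{x\}$, and adding the new first edge $\{1,x\}$. Let $\mathcal T(M,0)=\{M\}$ and let $\mathcal T(M,l+1)$ be the set of all children of the elements of $\mathcal T(M,l)$. Matchings $M,N\in\mathcal M(n)$ are nesting-similar, $M\sim_{ne}N$, if for every $l\ge 0$ and every $k\ge 0$ the sets $\mathcal T(M,l)$ and $\mathcal T(N,l)$ contain the same number of matchings with exactly $k$ nestings. Let $\mathcal D(n)$ be the set of Dyck paths of semilength $n$, that is, lattice paths from $(0,0)$ to $(2n,0)$ with steps $(1,1)$ and $(1,-1)$ that never go below the $x$-axis. A tunnel in $D\in\mathcal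 D(n)$ is a horizontal segment at an altitude $h+\tfrac12$, $h\in\{0,1,2,\dots\}$, that lies below $D$ and meets $D$ exactly in its two endpoints. A tunnel covers another tunnel if its projection on the $x$-axis contains the projection of the other. Let $ne(D)$ be the number of ordered pairs $(t_1,t_2)$ of distinct tunnels in $D$ such that $t_1$ covers $t_2$. Then the number of nesting-similarity classes of matchings on $[2n]$ is $$|\mathcal M(n)/\!\sim_{ne}|\;=\;2\cdot 4^{n-1}-\frac{3n-1}{2n+2}\binom{2n}{n},$$ and moreover $$|\mathcal M(n)/\!\sim_{ne}|\;=\;\sum_{D\in\mathcal D(n)}\bigl(1+ne(D)\bigr).$$ -/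

import Mathlib

/-- A matching on `[2n] = {1, …, 2n}`: a set partition of `[2n]` all of whose blocks (edges) have
two elements. For `n = 0` this is the empty matching only. -/
abbrev Matching (n : ℕ) : Type :=
  {M : Finpartition (Finset.Icc 1 (2 * n)) // ∀ B ∈ M.parts, B.card = 2}

namespace Matching

/-- The set of edges of a matching. -/
def edges {n : ℕ} (M : Matching n) : Finset (Finset ℕ) := M.1.parts

/-- For two-element sets `A` and `B` this says `min A < min B < max B < max A`. -/
def Nests (A B : Finset ℕ) : Prop :=
  ∃ a ∈ A, ∃ d ∈ A, ∃ b ∈ B, ∃ c ∈ B, a < b ∧ b < c ∧ c < d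

instance (A B : Finset ℕ) : Decidable (Nests A B) := by
  unfold Nests; infer_instance

/-- The number `ne(M)` of nestings of `M`. Every unordered pair of nested edges is counted once,
as `(A, B)` with `A` the outer and `B` the inner edge. -/
def ne {n : ℕ} (M : Matching n) : ℕ :=
  ((M.edges ×ˢ M.edges).filter fun p => Nests p.1 p.2).card

/-- The order-preserving relabelling of `1, 2, 3, …` by the elements of `{2, 3, …} \ {x}`
(for `x ≥ 2`). -/
def relabel (x k : ℕ) : ℕ := if k + 1 < x then k + 1 else k + 2

/-- `N` arises from `M` by adding a new first edge `{1, x}`, where `x ∈ {2, …, 2n+2}` and the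
vertices of `M` are relabelled, in the same order, as `{2, …, 2n+2} \ {x}`. -/
def IsChild {n : ℕ} (M : Matching n) (N : Matching (n + 1)) : Prop :=
  ∃ x ∈ Finset.Icc 2 (2 * n + 2),
    N.edges = insert {1, x} (M.edges.image fun B => B.image (relabel x))

/-- The `l`-th level of the subtree, rooted in `M`, of the tree of matchings. -/
def level {n : ℕ} (M : Matching n) : (l : ℕ) → Set (Matching (n + l))
  | 0 => {M}
  | l + 1 => {N | ∃ N' ∈ level M l, IsChild N' N}

/-- The multiset of the numbers of nestings of the matchings on the `l`-th level below `M`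
(each value with the multiplicity with which it is attained). -/
noncomputable def neLevel {n : ℕ} (M : Matching n) (l : ℕ) : Multiset ℕ :=
  (Set.toFinite (level M l)).toFinset.val.map ne

/-- Nesting-similarity of matchings on `[2n]`, with the proof that it is an equivalence. -/
def nestingSimilarity (n : ℕ) : Setoid (Matching n) where
  r M N := ∀ l : ℕ, neLevel M l = neLevel N l
  iseqv := ⟨fun _ _ => rfl, fun h l => (h l).symm, fun h k l => (h l).trans (k l)⟩

end Matching

namespace DyckWord

/-- The altitude of the lattice point reached after the first `i` steps of a Dyck path
(a Dyck word, read as a sequence of up-steps `U` and down-steps `D`). -/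
def altitude (p : DyckWord) (i : ℕ) : ℤ :=
  ((p.toList.take i).count DyckStep.U : ℤ) - ((p.toList.take i).count DyckStep.D : ℤ)

/-- Tunnels of a Dyck path. A tunnel is a horizontal segment at an altitude `h + 1/2`, `h ∈ ℕ`,
lying below the path and meeting it only in its two endpoints. The endpoints are then the
midpoints of an up-step and of a later down-step, between which all the lattice points of the
path have altitude more than `h`. The tunnel from `(i + 1/2, h + 1/2)` to `(j + 1/2, h + 1/2)`
is recorded as the pair `(i, j)`, step number `i` being the one that leaves the `i`-th lattice
point (counted from `0`). -/
def tunnels (p : DyckWord) : Finset (ℕ × ℕ) :=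
  (Finset.range p.toList.length ×ˢ Finset.range p.toList.length).filter fun t =>
    t.1 < t.2 ∧ p.toList[t.1]? = some DyckStep.U ∧ p.toList[t.2]? = some DyckStep.D ∧
      p.altitude (t.2 + 1) = p.altitude t.1 ∧
      ∀ k ∈ Finset.Ioc t.1 t.2, p.altitude t.1 < p.altitude k

/-- The number of ordered pairs `(t₁, t₂)` of distinct tunnels such that `t₁` covers `t₂`, that is,
the projection of `t₁` to the horizontal axis contains that of `t₂`. -/
def numCoveringPairs (p : DyckWord) : ℕ :=
  ((p.tunnels ×ˢ p.tunnels).filter fun q =>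
    q.1 ≠ q.2 ∧ q.1.1 ≤ q.2.1 ∧ q.2.2 ≤ q.1.2).card

end DyckWord

/-! Attach to a matching `M` its profile: the Dyck path with a down-step at the larger vertex of
each edge, together with `ne M`. If the new first edge closes after the first `j` vertices of `M`,
the path changes by `insertArc`, and `ne` grows by the number of down-steps among the first `j`
letters, because the edges nested under the new edge are those that lie within these vertices. So
the profile determines the profiles of all descendants. Conversely, level 0 yields `ne M`, and level
1 yields the multiset of the prefix counts of down-steps, which are monotone in `j` and hence
determine the path. Similarity is therefore equality of profiles (`nestingSimilarity_eq_ker`).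

A pair `(w, k)` is a profile exactly if `w` is a Dyck path and `k ≤ coverWeight 0 w`. The bound
holds because an insertion raises the cover weight by the increment of `ne` plus a nonnegative
altitude; it is attained because `StaysNonneg.exists_split` finds a removable arc in every
admissible pair. The cover weight counts the covering pairs of tunnels (`numCoveringPairs_eq`),
which gives the sum over Dyck paths. Its closed form follows from the first-return decomposition and
generating functions. -/

/-! ### Cover weight and height of paths. -/

open DyckStep in
/-- The sum of `h - 1` over all down-steps of a path starting at altitude `h₀`, where `h` is the
altitude at which the down-step starts. -/
def coverWeight : ℤ → List DyckStep → ℤ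
  | _, [] => 0
  | h, U :: l => coverWeight (h + 1) l
  | h, D :: l => (h - 1) + coverWeight (h - 1) l

/-- The difference between the final and the initial altitude of a path. -/
def pathHeight (l : List DyckStep) : ℤ :=
  (l.count DyckStep.U : ℤ) - (l.count DyckStep.D : ℤ)

@[simp] lemma pathHeight_nil : pathHeight [] = 0 := rfl

@[simp] lemma pathHeight_cons_U (l : List DyckStep) :
    pathHeight (DyckStep.U :: l) = pathHeight l + 1 := by
  simp [pathHeight]; ring

@[simp] lemma pathHeight_cons_D (l : List DyckStep) :
    pathHeight (DyckStep.D :: l) = pathHeight l - 1 := by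
  simp [pathHeight]; ring

@[simp] lemma pathHeight_append (a b : List DyckStep) :
    pathHeight (a ++ b) = pathHeight a + pathHeight b := by
  simp [pathHeight]; ring

lemma coverWeight_append (h : ℤ) (a b : List DyckStep) :
    coverWeight h (a ++ b) = coverWeight h a + coverWeight (h + pathHeight a) b := by
  induction a generalizing h with
  | nil => simp [coverWeight]
  | cons s a ih =>
    cases s
    · simp only [List.cons_append, coverWeight, ih, pathHeight_cons_U]
      congr 2; ring
    · simp only [List.cons_append, coverWeight, ih, pathHeight_cons_D]
      rw [add_assoc]; congr 3; ring

lemma coverWeight_add (h c : ℤ) (a : List DyckStep) :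
    coverWeight (h + c) a = coverWeight h a + c * a.count DyckStep.D := by
  induction a generalizing h with
  | nil => simp [coverWeight]
  | cons s a ih =>
    cases s
    · simp only [coverWeight]
      rw [add_right_comm, ih]; simp
    · simp only [coverWeight]
      rw [show h + c - 1 = h - 1 + c by ring, ih]; simp; ring

namespace DyckWord

lemma pathHeight_toList (p : DyckWord) : pathHeight p.toList = 0 := by
  simp [pathHeight, p.count_U_eq_count_D]

/-- Nesting lifts `p` by one, so each of its down-steps gains 1; the down-step closing the nest
starts at altitude 1 and contributes 0. -/
lemma coverWeight_nest_add (p q : DyckWord) :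
    coverWeight 0 (p.nest + q).toList =
      coverWeight 0 p.toList + p.semilength + coverWeight 0 q.toList := by
  have h : (p.nest + q).toList = DyckStep.U :: (p.toList ++ DyckStep.D :: q.toList) := by
    change ([DyckStep.U] ++ p.toList ++ [DyckStep.D]) ++ q.toList = _
    simp
  rw [h, coverWeight, coverWeight_append, coverWeight_add, pathHeight_toList, coverWeight,
    semilength_eq_count_D]
  simp

/-! ### The total cover weight of all Dyck paths of given semilength. -/

open BinaryTree in
/-- The sum of the cover weights of all Dyck words of semilength `n`. -/
def totalCoverWeight (n : ℕ) : ℤ :=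
  ∑ t ∈ treesOfNumNodesEq n, coverWeight 0 (ofTree t).toList

open BinaryTree in
lemma sum_coverWeight (n : ℕ) :
    ∑ p : {p : DyckWord // p.semilength = n}, coverWeight 0 p.1.toList = totalCoverWeight n := by
  rw [totalCoverWeight, ← Finset.sum_coe_sort (treesOfNumNodesEq n)]
  refine Fintype.sum_equiv (equivTreesOfNumNodesEq n) _ _ fun p => ?_
  change _ = coverWeight 0 (ofTree (toTree p.1)).toList
  rw [ofTree_toTree]

lemma totalCoverWeight_zero : totalCoverWeight 0 = 0 := by
  simp [totalCoverWeight, ofTree, coverWeight, show (0 : DyckWord).toList = [] from rfl]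

open BinaryTree in
lemma totalCoverWeight_succ (n : ℕ) :
    totalCoverWeight (n + 1) = ∑ ij ∈ Finset.HasAntidiagonal.antidiagonal n,
      (totalCoverWeight ij.1 * catalan ij.2 + ij.1 * catalan ij.1 * catalan ij.2 +
        catalan ij.1 * totalCoverWeight ij.2) := by
  rw [totalCoverWeight, treesOfNumNodesEq_succ, Finset.sum_biUnion]
  · refine Finset.sum_congr rfl fun ij _ => ?_
    rw [pairwiseNode, Finset.sum_map, Finset.sum_product]
    have h : ∀ a ∈ treesOfNumNodesEq ij.1, ∀ b ∈ treesOfNumNodesEq ij.2,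
        coverWeight 0 (ofTree (a △ b)).toList = coverWeight 0 (ofTree a).toList + ij.1 +
          coverWeight 0 (ofTree b).toList := by
      intro a ha b _
      have h1 : (ofTree a).semilength = ij.1 := by
        rw [← numNodes_toTree, toTree_ofTree]; exact mem_treesOfNumNodesEq.1 ha
      rw [ofTree, coverWeight_nest_add, h1]
    trans ∑ a ∈ treesOfNumNodesEq ij.1, ∑ b ∈ treesOfNumNodesEq ij.2,
      (coverWeight 0 (ofTree a).toList + ij.1 + coverWeight 0 (ofTree b).toList)
    · exact Finset.sum_congr rfl fun a ha => Finset.sum_congr rfl fun b hb => h a ha b hb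
    · simp only [Finset.sum_add_distrib, Finset.sum_const, treesOfNumNodesEq_card_eq_catalan,
        nsmul_eq_mul, ← Finset.mul_sum]
      simp only [totalCoverWeight]
      ring
  · intro i _ j _ hij
    refine Finset.disjoint_left.2 fun t hi hj => hij ?_
    simp only [pairwiseNode, Finset.mem_map, Finset.mem_product, mem_treesOfNumNodesEq] at hi hj
    obtain ⟨a, ⟨ha1, ha2⟩, rfl⟩ := hi
    obtain ⟨b, ⟨hb1, hb2⟩, h⟩ := hj
    obtain ⟨-, h1, h2⟩ := BinaryTree.node.inj h
    ext
    · rw [← ha1, ← hb1, h1]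
    · rw [← ha2, ← hb2, h2]

-- With `C`, `S`, `E` the generating functions of `catalan n`, `totalCoverWeight n` and `n * catalan
-- n`, the equations for `S` and `E` are linear with the common factor `1 - 2XC`. The square of this
-- factor is `1 - 4X`, so eliminating `E` leaves only `C` on the right.
open PowerSeries in
lemma totalCoverWeight_succ_sub (n : ℕ) :
    totalCoverWeight (n + 1) - 4 * totalCoverWeight n = catalan (n + 1) - catalan n := by
  set C : PowerSeries ℤ := PowerSeries.mk fun n => (catalan n : ℤ) with hC
  set S : PowerSeries ℤ := PowerSeries.mk fun n => totalCoverWeight n with hS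
  set E : PowerSeries ℤ := PowerSeries.mk fun n => (n : ℤ) * catalan n with hE
  have h1 : C = 1 + X * (C * C) := by
    ext m
    cases m with
    | zero => simp [hC]
    | succ m =>
      rw [map_add, coeff_succ_X_mul, coeff_mul]
      simp [hC, catalan_succ', coeff_one]
  have h2 : S = X * (S * C + E * C + C * S) := by
    ext m
    cases m with
    | zero => simp [hS, coeff_zero_X_mul, totalCoverWeight_zero]
    | succ m =>
      rw [coeff_succ_X_mul, map_add, map_add, coeff_mul, coeff_mul, coeff_mul]
      simp [hC, hS, hE, totalCoverWeight_succ, Finset.sum_add_distrib]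
  -- The Catalan recursion weighted by `m + 1 = 1 + i + j`, where `i + j = m`.
  have h3 : E = X * (C * C + (E * C + C * E)) := by
    ext m
    cases m with
    | zero => simp [hE, coeff_zero_X_mul]
    | succ m =>
      rw [coeff_succ_X_mul, map_add, map_add, coeff_mul, coeff_mul, coeff_mul]
      simp only [hC, hE, coeff_mk, ← Finset.sum_add_distrib, catalan_succ']
      push_cast
      rw [Finset.mul_sum]
      refine Finset.sum_congr rfl fun ij h => ?_
      rw [← Finset.HasAntidiagonal.mem_antidiagonal.1 h]
      push_cast
      ring
  have h4 : (1 - 4 * X) * S = C - 1 - X * C := by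
    have a : (1 - 2 * X * C) * S = X * E * C := by linear_combination h2
    have b : (1 - 2 * X * C) * E = X * C * C := by linear_combination h3
    have c : (1 - 2 * X * C) * (1 - 2 * X * C) = 1 - 4 * X := by linear_combination (-4 * X) * h1
    linear_combination (1 - 2 * X * C) * a + X * C * b - S * c - (X * C + 1) * h1
  have h5 := congrArg (coeff (n + 1)) h4
  have h6 : (1 - 4 * X) * S = S - X * ((4 : ℤ) • S) := by
    rw [zsmul_eq_mul]; push_cast; ring
  rw [h6, map_sub, map_sub, map_sub, coeff_succ_X_mul, coeff_succ_X_mul, map_zsmul] at h5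
  simpa [hS, hC, coeff_one] using h5

lemma catalan_succ_mul (n : ℕ) : ((n : ℚ) + 2) * catalan (n + 1) = 2 * (2 * n + 1) * catalan n := by
  have h1 := succ_mul_catalan_eq_centralBinom n
  have h2 := succ_mul_catalan_eq_centralBinom (n + 1)
  have h3 := Nat.succ_mul_centralBinom_succ n
  rw [← h1, ← h2] at h3
  have h4 : ((n : ℚ) + 1) * ((n + 1 + 1) * catalan (n + 1)) =
    2 * (2 * n + 1) * ((n + 1) * catalan n) := by exact_mod_cast h3
  have : (n : ℚ) + 1 ≠ 0 := by positivity
  apply mul_left_cancel₀ this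
  linear_combination h4

lemma totalCoverWeight_eq (n : ℕ) :
    2 * (totalCoverWeight n : ℚ) = 4 ^ n - (3 * n + 1) * catalan n := by
  induction n with
  | zero => simp [totalCoverWeight_zero]
  | succ n ih =>
    have h : (totalCoverWeight (n + 1) : ℚ) - 4 * totalCoverWeight n =
      catalan (n + 1) - catalan n := by exact_mod_cast totalCoverWeight_succ_sub n
    have h2 := catalan_succ_mul n
    push_cast
    linear_combination 2 * h + 4 * ih + 3 * h2

lemma catalan_add_totalCoverWeight (n : ℕ) (hn : 1 ≤ n) :
    (catalan n : ℚ) + totalCoverWeight n =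
      2 * 4 ^ (n - 1) - (3 * (n : ℚ) - 1) / (2 * (n : ℚ) + 2) * ((2 * n).choose n : ℚ) := by
  have h1 : ((n : ℚ) + 1) * catalan n = (2 * n).choose n := by
    exact_mod_cast succ_mul_catalan_eq_centralBinom n
  have h2 := totalCoverWeight_eq n
  obtain ⟨m, rfl⟩ : ∃ m, n = m + 1 := ⟨n - 1, by omega⟩
  rw [← h1]
  have : (2 * ((m + 1 : ℕ) : ℚ) + 2) ≠ 0 := by positivity
  field_simp
  rw [Nat.add_sub_cancel]
  rw [pow_succ] at h2
  linear_combination h2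

end DyckWord

/-! ### Nonnegative paths, insertion and removal of a first arc. -/

open DyckStep in
/-- A path starting at altitude `h` never goes below altitude `0`. -/
def StaysNonneg : ℤ → List DyckStep → Prop
  | h, [] => 0 ≤ h
  | h, U :: l => 0 ≤ h ∧ StaysNonneg (h + 1) l
  | h, D :: l => 0 ≤ h ∧ StaysNonneg (h - 1) l

lemma StaysNonneg.nonneg {h : ℤ} {l : List DyckStep} (hl : StaysNonneg h l) : 0 ≤ h := by
  cases l with
  | nil => exact hl
  | cons s l => cases s <;> exact hl.1

lemma StaysNonneg.mono {h h' : ℤ} {l : List DyckStep} (hl : StaysNonneg h l) (hh : h ≤ h') :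
    StaysNonneg h' l := by
  induction l generalizing h h' with
  | nil => exact le_trans hl hh
  | cons s l ih =>
    cases s
    · exact ⟨hl.1.trans hh, ih hl.2 (by omega)⟩
    · exact ⟨hl.1.trans hh, ih hl.2 (by omega)⟩

lemma staysNonneg_append {h : ℤ} {a b : List DyckStep} :
    StaysNonneg h (a ++ b) ↔ StaysNonneg h a ∧ StaysNonneg (h + pathHeight a) b := by
  induction a generalizing h with
  | nil => simpa [StaysNonneg] using fun hb => hb.nonneg
  | cons s a ih =>
    cases s
    · simp only [List.cons_append, StaysNonneg, ih, pathHeight_cons_U, and_assoc,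
        show h + 1 + pathHeight a = h + (pathHeight a + 1) by ring]
    · simp only [List.cons_append, StaysNonneg, ih, pathHeight_cons_D, and_assoc,
        show h - 1 + pathHeight a = h + (pathHeight a - 1) by ring]

lemma StaysNonneg.coverWeight_nonneg {h : ℤ} {l : List DyckStep} (hl : StaysNonneg h l) :
    0 ≤ coverWeight h l := by
  induction l generalizing h with
  | nil => exact le_rfl
  | cons s l ih =>
    cases s
    · exact ih hl.2
    · exact add_nonneg hl.2.nonneg (ih hl.2)

lemma StaysNonneg.pathHeight_nonneg {h : ℤ} {l : List DyckStep} (hl : StaysNonneg h l) :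
    0 ≤ h + pathHeight l := by
  rw [← List.append_nil l, staysNonneg_append] at hl
  simpa using hl.2.nonneg

lemma staysNonneg_iff {h : ℤ} {l : List DyckStep} :
    StaysNonneg h l ↔ ∀ i, 0 ≤ h + pathHeight (l.take i) := by
  constructor
  · intro hl i
    rw [← List.take_append_drop i l, staysNonneg_append] at hl
    exact hl.1.pathHeight_nonneg
  · intro hl
    induction l generalizing h with
    | nil => simpa [StaysNonneg] using hl 0
    | cons s l ih =>
      cases s
      · refine ⟨by simpa using hl 0, ih fun i => ?_⟩
        have := hl (i + 1)
        rw [List.take_succ_cons, pathHeight_cons_U] at this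
        linarith
      · refine ⟨by simpa using hl 0, ih fun i => ?_⟩
        have := hl (i + 1)
        rw [List.take_succ_cons, pathHeight_cons_D] at this
        linarith

/-- The down-step that is matched to an additional first up-step can be chosen such that at most
`k` down-steps precede it and at least `k` remains after paying for its altitude. -/
lemma StaysNonneg.exists_split {h : ℤ} {v : List DyckStep} (h0 : 0 ≤ h)
    (hv : StaysNonneg (h + 1) v) (hend : h + pathHeight v = -1) {k : ℤ} (hk : 0 ≤ k)
    (hkv : k ≤ coverWeight (h + 1) v) :
    ∃ p q, v = p ++ DyckStep.D :: q ∧ StaysNonneg h p ∧ (p.count DyckStep.D : ℤ) ≤ k ∧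
      h + pathHeight p ≤ coverWeight (h + 1) v - k := by
  induction v generalizing h k with
  | nil => simp at hend; omega
  | cons s v ih =>
    cases s with
    | U =>
      obtain ⟨p, q, rfl, h1, h2, h3⟩ := ih (h := h + 1) (by omega) hv.2
        (by rw [pathHeight_cons_U] at hend; linarith) hk hkv
      exact ⟨DyckStep.U :: p, q, rfl, ⟨h0, h1⟩, by simpa using h2, by
        rw [pathHeight_cons_U, coverWeight]; linarith⟩
    | D =>
      have hv2 := hv.2
      rw [add_sub_cancel_right] at hv2
      have hcv := hv2.coverWeight_nonneg
      rw [coverWeight, add_sub_cancel_right] at hkv ⊢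
      -- If the rest of the path has weight at least `k`, this down-step can be the match. Otherwise
      -- it is put into `p`, which uses up one unit of `k`; the minimum below keeps the new `k`
      -- within the weight of the rest.
      rcases (show h ≤ h + coverWeight h v - k ∨ (0 < h ∧ 0 < k) by omega) with hle | ⟨hpos, hkpos⟩
      · exact ⟨[], v, rfl, h0, by simpa using hk, by simpa using hle⟩
      · obtain ⟨p, q, rfl, h1, h2, h3⟩ := ih (h := h - 1) (k := min (k - 1) (coverWeight h v))
          (by omega) (by rwa [sub_add_cancel])
          (by rw [pathHeight_cons_D] at hend; linarith) (by omega)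
          (by rw [sub_add_cancel]; omega)
        rw [sub_add_cancel] at h3
        refine ⟨DyckStep.D :: p, q, rfl, ⟨h0, h1⟩, ?_, ?_⟩
        · rw [List.count_cons_self]; push_cast; omega
        · rw [pathHeight_cons_D]; omega

/-- The word that arises from `w` by adding a new first up-step and inserting the matching down-step
after the first `j` letters of `w`. -/
def insertArc (w : List DyckStep) (j : ℕ) : List DyckStep :=
  DyckStep.U :: (w.take j ++ DyckStep.D :: w.drop j)

lemma pathHeight_insertArc (w : List DyckStep) (j : ℕ) :
    pathHeight (insertArc w j) = pathHeight w := by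
  have h := congrArg pathHeight (List.take_append_drop j w)
  rw [pathHeight_append] at h
  simp only [insertArc, pathHeight_cons_U, pathHeight_append, pathHeight_cons_D]
  linarith

lemma StaysNonneg.insertArc {w : List DyckStep} (hw : StaysNonneg 0 w) (j : ℕ) :
    StaysNonneg 0 (insertArc w j) := by
  rw [← List.take_append_drop j w, staysNonneg_append] at hw
  refine ⟨le_rfl, staysNonneg_append.2 ⟨hw.1.mono (by omega), ?_, ?_⟩⟩
  · have := hw.2.nonneg; omega
  · convert hw.2 using 1; ring

/-- The prefix is lifted by one, which adds 1 per down-step in it; the inserted down-step starts one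
above the old altitude there and contributes that altitude. The suffix is unaffected. -/
lemma coverWeight_insertArc (w : List DyckStep) (j : ℕ) :
    coverWeight 0 (insertArc w j) =
      coverWeight 0 w + (w.take j).count DyckStep.D + pathHeight (w.take j) := by
  conv_rhs => enter [1, 1]; rw [← List.take_append_drop j w]
  rw [insertArc, coverWeight, coverWeight_append, coverWeight_append, coverWeight_add, coverWeight,
    show 0 + 1 + pathHeight (w.take j) - 1 = 0 + pathHeight (w.take j) by ring]
  ring

/-- The inverse of passing to a child, on the level of profiles: the induction step for realising
every admissible pair. -/
lemma StaysNonneg.exists_insertArc {w : List DyckStep} (hw : StaysNonneg 0 w)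
    (hend : pathHeight w = 0) (hne : w ≠ []) {k : ℕ} (hk : (k : ℤ) ≤ coverWeight 0 w) :
    ∃ (w' : List DyckStep) (j k' : ℕ), j ≤ w'.length ∧ w = _root_.insertArc w' j ∧
      k = k' + (w'.take j).count DyckStep.D ∧ StaysNonneg 0 w' ∧ (k' : ℤ) ≤ coverWeight 0 w' := by
  match w, hne with
  | DyckStep.D :: v, _ => exact absurd hw.2.nonneg (by norm_num)
  | DyckStep.U :: v, _ =>
    obtain ⟨p, q, rfl, h1, h2, h3⟩ := StaysNonneg.exists_split (h := 0) le_rfl hw.2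
      (by rw [pathHeight_cons_U] at hend; linarith) (Int.natCast_nonneg k) hk
    have e : DyckStep.U :: (p ++ DyckStep.D :: q) = _root_.insertArc (p ++ q) p.length := by
      simp [_root_.insertArc]
    have hc := coverWeight_insertArc (p ++ q) p.length
    rw [← e, coverWeight, List.take_left] at hc
    refine ⟨p ++ q, p.length, k - p.count DyckStep.D, by simp, e, ?_, ?_, ?_⟩
    · rw [List.take_left]; omega
    · refine staysNonneg_append.2 ⟨h1, ?_⟩
      have := (staysNonneg_append.1 hw.2).2.2
      convert this using 1; ring
    · omega

lemma eq_of_count_take_eq {w w' : List DyckStep} (hlen : w.length = w'.length)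
    (h : ∀ j ≤ w.length, (w.take j).count DyckStep.D = (w'.take j).count DyckStep.D) : w = w' := by
  refine List.ext_getElem hlen fun i hi hi' => ?_
  have h1 := h i hi.le
  have h2 := h (i + 1) hi
  rw [List.take_succ_eq_append_getElem hi, List.take_succ_eq_append_getElem hi', List.count_append,
    List.count_append, h1] at h2
  generalize w[i] = a at h2 ⊢
  generalize w'[i] = b at h2 ⊢
  cases a <;> cases b <;> simp at h2 ⊢

/-- The counts increase weakly with `j`, so sorting the multiset recovers them in order; their
successive differences are the letters. -/
lemma eq_of_map_count_take_eq {w w' : List DyckStep} (hlen : w.length = w'.length) (c : ℕ)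
    (h : (Multiset.range (w.length + 1)).map (fun j => c + (w.take j).count DyckStep.D) =
      (Multiset.range (w'.length + 1)).map (fun j => c + (w'.take j).count DyckStep.D)) :
    w = w' := by
  have hs : ∀ u : List DyckStep, ((List.range (u.length + 1)).map
      (fun j => c + (u.take j).count DyckStep.D)).Pairwise (· ≤ ·) := by
    intro u
    rw [List.pairwise_map]
    refine List.pairwise_lt_range.imp fun {a b} hab => ?_
    exact Nat.add_le_add_left ((List.take_sublist_take_left hab.le).count_le _) _
  rw [← Multiset.coe_range, ← Multiset.coe_range, Multiset.map_coe, Multiset.map_coe,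
    Multiset.coe_eq_coe] at h
  have he := h.eq_of_pairwise (fun a b _ _ h1 h2 => le_antisymm h1 h2) (hs w) (hs w')
  rw [hlen, List.map_inj_left] at he
  refine eq_of_count_take_eq hlen fun j hj => ?_
  have := he j (by rw [List.mem_range]; omega)
  omega

/-! ### Tunnels: the cover weight counts covering pairs. -/

namespace DyckWord

variable (p : DyckWord)

lemma altitude_eq_pathHeight (i : ℕ) : p.altitude i = pathHeight (p.toList.take i) := rfl

@[simp] lemma altitude_zero : p.altitude 0 = 0 := by simp [altitude]

lemma altitude_nonneg (i : ℕ) : 0 ≤ p.altitude i := by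
  have := p.count_D_le_count_U i
  rw [altitude]; omega

lemma altitude_length : p.altitude p.toList.length = 0 := by
  simp [altitude, p.count_U_eq_count_D]

lemma staysNonneg_toList : StaysNonneg 0 p.toList :=
  staysNonneg_iff.2 fun i => by simpa using! p.altitude_nonneg i

variable {p}

lemma altitude_succ_of_U {i : ℕ} (h : p.toList[i]? = some DyckStep.U) :
    p.altitude (i + 1) = p.altitude i + 1 := by
  rw [altitude_eq_pathHeight, altitude_eq_pathHeight, List.take_add_one, h]
  simp

lemma altitude_succ_of_D {i : ℕ} (h : p.toList[i]? = some DyckStep.D) :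
    p.altitude (i + 1) = p.altitude i - 1 := by
  rw [altitude_eq_pathHeight, altitude_eq_pathHeight, List.take_add_one, h]
  simp; ring

lemma getElem?_eq_U_or_D {i : ℕ} (h : i < p.toList.length) :
    p.toList[i]? = some DyckStep.U ∨ p.toList[i]? = some DyckStep.D := by
  rw [List.getElem?_eq_getElem h]
  cases p.toList[i] <;> simp

/-- A discrete intermediate value argument: take the last point up to `m` of altitude at most `h`.
-/
lemma exists_last_up_step {m : ℕ} (hm : m ≤ p.toList.length) {h : ℤ} (h0 : 0 ≤ h)
    (hh : h < p.altitude m) :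
    ∃ i < m, p.altitude i = h ∧ p.toList[i]? = some DyckStep.U ∧
      ∀ k, i < k → k ≤ m → h < p.altitude k := by
  classical
  set i := Nat.findGreatest (fun i => p.altitude i ≤ h) m with hi
  have hi1 : p.altitude i ≤ h :=
    Nat.findGreatest_spec (P := fun i => p.altitude i ≤ h) (Nat.zero_le m) (by simpa using h0)
  have hi2 : i ≤ m := Nat.findGreatest_le m
  have hi3 : i ≠ m := by rintro e; rw [e] at hi1; omega
  have hk : ∀ k, i < k → k ≤ m → h < p.altitude k := fun k h1 h2 =>
    not_le.1 (Nat.findGreatest_is_greatest h1 h2)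
  have h1 := hk (i + 1) (by omega) (by omega)
  rcases getElem?_eq_U_or_D (p := p) (i := i) (by omega) with e | e
  · have := altitude_succ_of_U e
    exact ⟨i, by omega, by omega, e, hk⟩
  · have := altitude_succ_of_D e
    omega

lemma exists_first_down_step {m : ℕ} (hm : m ≤ p.toList.length) {h : ℤ} (h0 : 0 ≤ h)
    (hh : h < p.altitude m) :
    ∃ j, m ≤ j ∧ j < p.toList.length ∧ p.altitude (j + 1) = h ∧
      p.toList[j]? = some DyckStep.D ∧ ∀ k, m ≤ k → k ≤ j → h < p.altitude k := by
  classical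
  have hex : ∃ j, m ≤ j ∧ p.altitude j ≤ h := ⟨_, hm, by rwa [altitude_length]⟩
  obtain ⟨h1, h2⟩ := Nat.find_spec hex
  have h3 : Nat.find hex ≤ p.toList.length := Nat.find_min' hex ⟨hm, by rwa [altitude_length]⟩
  have h4 : ∀ k, m ≤ k → k < Nat.find hex → h < p.altitude k := fun k ha hb => by
    by_contra hc
    exact Nat.find_min hex hb ⟨ha, not_lt.1 hc⟩
  generalize Nat.find hex = j at *
  have h5 : m ≠ j := by rintro rfl; omega
  obtain ⟨i, rfl⟩ : ∃ i, j = i + 1 := ⟨j - 1, by omega⟩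
  have h6 := h4 i (by omega) (by omega)
  rcases getElem?_eq_U_or_D (p := p) (i := i) (by omega) with e | e
  · have := altitude_succ_of_U e
    omega
  · have := altitude_succ_of_D e
    exact ⟨i, by omega, by omega, by omega, e, fun k ha hb => h4 k ha (by omega)⟩

lemma mem_tunnels {i j : ℕ} : (i, j) ∈ p.tunnels ↔
    i < j ∧ p.toList[i]? = some DyckStep.U ∧ p.toList[j]? = some DyckStep.D ∧
      p.altitude (j + 1) = p.altitude i ∧ ∀ k, i < k → k ≤ j → p.altitude i < p.altitude k := by
  simp only [tunnels, Finset.mem_filter, Finset.mem_product, Finset.mem_range, Finset.mem_Ioc,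
    and_imp, and_iff_right_iff_imp]
  rintro - h1 h2 - -
  exact ⟨(List.getElem?_eq_some_iff.1 h1).1, (List.getElem?_eq_some_iff.1 h2).1⟩

lemma fst_eq_of_mem_tunnels {i i' j : ℕ} (h : (i, j) ∈ p.tunnels) (h' : (i', j) ∈ p.tunnels) :
    i = i' := by
  rw [mem_tunnels] at h h'
  obtain ⟨a1, -, -, a2, a3⟩ := h
  obtain ⟨b1, -, -, b2, b3⟩ := h'
  rcases lt_trichotomy i i' with hl | hl | hl
  · have := a3 i' hl b1.le; omega
  · exact hl
  · have := b3 i hl a1.le; omega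

lemma snd_eq_of_mem_tunnels {i j j' : ℕ} (h : (i, j) ∈ p.tunnels) (h' : (i, j') ∈ p.tunnels) :
    j = j' := by
  rw [mem_tunnels] at h h'
  obtain ⟨a1, -, -, a2, a3⟩ := h
  obtain ⟨b1, -, -, b2, b3⟩ := h'
  rcases lt_trichotomy j j' with hl | hl | hl
  · have := b3 (j + 1) (by omega) hl; omega
  · exact hl
  · have := a3 (j' + 1) (by omega) hl; omega

lemma lt_of_mem_tunnels_of_covers {s t : ℕ × ℕ} (hs : s ∈ p.tunnels) (ht : t ∈ p.tunnels)
    (hne : s ≠ t) (h : s.1 ≤ t.1) : s.1 < t.1 := by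
  refine lt_of_le_of_ne h fun e => hne ?_
  obtain ⟨i, j⟩ := s
  obtain ⟨i', j'⟩ := t
  obtain rfl : i = i' := e
  rw [snd_eq_of_mem_tunnels hs ht]

/-- There is exactly one covering tunnel for each altitude from 0 up to that of `t`, excluded: its
ends are the last up-step before `t` and the first down-step after `t` at that level. -/
lemma card_covering_tunnels {t : ℕ × ℕ} (ht : t ∈ p.tunnels) :
    ((p.tunnels.filter fun s => s ≠ t ∧ s.1 ≤ t.1 ∧ t.2 ≤ s.2).card : ℤ) = p.altitude t.1 := by
  have ht' := mem_tunnels.1 ht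
  obtain ⟨t1, t2, t3, t4, t5⟩ := ht'
  have hlen : t.2 < p.toList.length := (List.getElem?_eq_some_iff.1 t3).1
  rw [← Int.toNat_of_nonneg (p.altitude_nonneg t.1), Nat.cast_inj, ← Finset.card_range (p.altitude t.1).toNat]
  refine Finset.card_nbij (fun s => (p.altitude s.1).toNat) ?_ ?_ ?_
  · rintro s hs
    simp only [Finset.coe_filter, Set.mem_ofPred_eq] at hs
    obtain ⟨hs, hne, h1, h2⟩ := hs
    have hlt := lt_of_mem_tunnels_of_covers hs ht hne h1
    have := (mem_tunnels.1 hs).2.2.2.2 t.1 hlt (by omega)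
    have := p.altitude_nonneg s.1
    simp only [Finset.coe_range, Set.mem_Iio]
    omega
  · rintro ⟨i, j⟩ hs ⟨i', j'⟩ hs' e
    simp only [Finset.coe_filter, Set.mem_ofPred_eq] at hs hs' e
    obtain ⟨hs, -, h1, h2⟩ := hs
    obtain ⟨hs', -, h1', h2'⟩ := hs'
    have ha := p.altitude_nonneg i
    have hb := p.altitude_nonneg i'
    -- Of two covering tunnels at one level, the later would start inside the earlier, where the
    -- path is strictly higher.
    have e' : i = i' := by
      rcases lt_trichotomy i i' with hl | hl | hl
      · have := (mem_tunnels.1 hs).2.2.2.2 i' hl (by omega); omega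
      · exact hl
      · have := (mem_tunnels.1 hs').2.2.2.2 i hl (by omega); omega
    subst e'
    rw [snd_eq_of_mem_tunnels hs hs']
  · intro h hh
    simp only [Finset.coe_range, Set.mem_Iio] at hh
    obtain ⟨i, i1, i2, i3, i4⟩ := exists_last_up_step (p := p) (m := t.1) (h := h) (by omega)
      (by omega) (by omega)
    have hj : p.altitude t.1 < p.altitude t.2 := t5 t.2 t1 le_rfl
    obtain ⟨j, j1, j2, j3, j4, j5⟩ := exists_first_down_step (p := p) (m := t.2) (h := h) (by omega)
      (by omega) (by omega)
    refine ⟨(i, j), ?_, by simp [i2]⟩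
    simp only [Finset.coe_filter, Set.mem_ofPred_eq]
    refine ⟨mem_tunnels.2 ⟨by omega, i3, j4, by omega, fun k hk1 hk2 => ?_⟩, ?_, i1.le, j1⟩
    · rw [i2]
      rcases le_or_gt k t.1 with hk | hk
      · exact i4 k hk1 hk
      · rcases le_or_gt k t.2 with hk' | hk'
        · have := t5 k hk hk'; omega
        · exact j5 k hk'.le hk2
    · rintro rfl
      exact lt_irrefl _ i1

lemma coverWeight_take {m : ℕ} (hm : m ≤ p.toList.length) :
    coverWeight 0 (p.toList.take m) =
      ∑ j ∈ (Finset.range m).filter (fun j => p.toList[j]? = some DyckStep.D),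
        (p.altitude j - 1) := by
  induction m with
  | zero => simp [coverWeight]
  | succ m ih =>
    rw [List.take_add_one, coverWeight_append, ih (by omega), Finset.range_add_one,
      Finset.filter_insert, ← altitude_eq_pathHeight]
    rcases getElem?_eq_U_or_D (p := p) (i := m) (by omega) with e | e
    · simp [e, coverWeight]
    · simp [e, coverWeight]
      ring

/-- Group the pairs by the covered tunnel. Tunnels correspond to down-steps through their right
ends, and such a down-step starts one above the altitude at the tunnel's left end. -/
lemma numCoveringPairs_eq (p : DyckWord) : (p.numCoveringPairs : ℤ) = coverWeight 0 p.toList := by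
  have h1 := coverWeight_take (p := p) le_rfl
  rw [List.take_length] at h1
  rw [h1, numCoveringPairs, Finset.card_filter, Finset.sum_product_right]
  push_cast
  trans ∑ t ∈ p.tunnels, p.altitude t.1
  · refine Finset.sum_congr rfl fun t ht => ?_
    rw [← card_covering_tunnels ht, Finset.card_filter]
    push_cast
    rfl
  · refine Finset.sum_nbij Prod.snd ?_ ?_ ?_ ?_
    · rintro ⟨i, j⟩ ht
      rw [mem_tunnels] at ht
      simp only [Finset.mem_filter, Finset.mem_range]
      exact ⟨(List.getElem?_eq_some_iff.1 ht.2.2.1).1, ht.2.2.1⟩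
    · rintro ⟨i, j⟩ ht ⟨i', j'⟩ ht' rfl
      rw [fst_eq_of_mem_tunnels ht ht']
    · intro j hj
      simp only [Finset.coe_filter, Finset.mem_range, Set.mem_ofPred_eq] at hj
      have h2 := altitude_succ_of_D hj.2
      have h3 := p.altitude_nonneg (j + 1)
      obtain ⟨i, i1, i2, i3, i4⟩ := exists_last_up_step (p := p) (m := j) hj.1.le
        (h := p.altitude j - 1) (by omega) (by omega)
      exact ⟨(i, j), mem_tunnels.2 ⟨i1, i3, hj.2, by omega, by rwa [i2]⟩, rfl⟩
    · rintro ⟨i, j⟩ ht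
      rw [mem_tunnels] at ht
      have h2 := altitude_succ_of_D ht.2.2.1
      simp only; omega

end DyckWord

/-! ### The tree of matchings: children and parents. -/

namespace Matching

variable {n : ℕ} {M M' : Matching n} {N : Matching (n + 1)} {x x' : ℕ}

lemma ext_edges (h : M.edges = M'.edges) : M = M' := Subtype.ext (Finpartition.ext h)

lemma edge_subset {B : Finset ℕ} (hB : B ∈ M.edges) : B ⊆ Finset.Icc 1 (2 * n) := M.1.le hB

lemma card_edge {B : Finset ℕ} (hB : B ∈ M.edges) : B.card = 2 := M.2 B hB

lemma one_le_of_mem_edge {B : Finset ℕ} (hB : B ∈ M.edges) {v : ℕ} (hv : v ∈ B) : 1 ≤ v :=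
  (Finset.mem_Icc.1 (edge_subset hB hv)).1

lemma eq_of_mem_edges {B B' : Finset ℕ} (hB : B ∈ M.edges) (hB' : B' ∈ M.edges) {v : ℕ}
    (hv : v ∈ B) (hv' : v ∈ B') : B = B' :=
  M.1.eq_of_mem_parts hB hB' hv hv'

lemma exists_edge_mem (M : Matching n) {v : ℕ} (hv : v ∈ Finset.Icc 1 (2 * n)) :
    ∃ B ∈ M.edges, v ∈ B := M.1.exists_mem hv

lemma exists_matching_of_edges (E : Finset (Finset ℕ)) (hcard : ∀ B ∈ E, B.card = 2)
    (hsub : ∀ B ∈ E, B ⊆ Finset.Icc 1 (2 * n))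
    (hdisj : ∀ B ∈ E, ∀ B' ∈ E, ∀ v ∈ B, v ∈ B' → B = B')
    (hcover : ∀ v ∈ Finset.Icc 1 (2 * n), ∃ B ∈ E, v ∈ B) : ∃ M : Matching n, M.edges = E := by
  refine ⟨⟨Finpartition.ofExistsUnique E hsub (fun v hv => ?_) fun h => ?_, hcard⟩, rfl⟩
  · obtain ⟨B, hB, hvB⟩ := hcover v hv
    exact ⟨B, ⟨hB, hvB⟩, fun B' hB' => (hdisj B hB B' hB'.1 v hvB hB'.2).symm⟩
  · simpa using hcard _ h

lemma relabel_strictMono (x : ℕ) : StrictMono (relabel x) := by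
  intro a b hab
  simp only [relabel]
  split_ifs <;> omega

lemma relabel_ne (x k : ℕ) : relabel x k ≠ x := by
  simp only [relabel]
  split_ifs <;> omega

lemma relabel_le_add_two (x k : ℕ) : relabel x k ≤ k + 2 := by
  simp only [relabel]
  split_ifs <;> omega

lemma add_one_le_relabel (x k : ℕ) : k + 1 ≤ relabel x k := by
  simp only [relabel]
  split_ifs <;> omega

lemma relabel_lt_iff (x k : ℕ) : relabel x k < x ↔ k + 2 ≤ x := by
  simp only [relabel]
  split_ifs <;> omega

lemma exists_relabel_eq {v m : ℕ} (hx : x ∈ Finset.Icc 2 (m + 2)) (hv : v ∈ Finset.Icc 1 (m + 2))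
    (h1 : v ≠ 1) (hvx : v ≠ x) : ∃ k ∈ Finset.Icc 1 m, relabel x k = v := by
  rw [Finset.mem_Icc] at hx hv
  rcases lt_or_gt_of_ne hvx with h | h
  · exact ⟨v - 1, Finset.mem_Icc.2 ⟨by omega, by omega⟩, by
      rw [relabel, if_pos (by omega)]; omega⟩
  · exact ⟨v - 2, Finset.mem_Icc.2 ⟨by omega, by omega⟩, by
      rw [relabel, if_neg (by omega)]; omega⟩

lemma image_relabel_injective (x : ℕ) :
    Function.Injective fun B : Finset ℕ => B.image (relabel x) :=
  Finset.image_injective (relabel_strictMono x).injective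

lemma one_notMem_image_relabel {B : Finset ℕ} (hB : B ∈ M.edges) : 1 ∉ B.image (relabel x) := by
  intro h
  obtain ⟨k, hk, hk1⟩ := Finset.mem_image.1 h
  have := one_le_of_mem_edge hB hk
  have := add_one_le_relabel x k
  omega

lemma notMem_image_relabel {B : Finset ℕ} : x ∉ B.image (relabel x) := by
  intro h
  obtain ⟨k, -, hk⟩ := Finset.mem_image.1 h
  exact relabel_ne x k hk

/-- `N` is the child of `M` with first edge `{1, x}`. -/
def IsChildAt (M : Matching n) (x : ℕ) (N : Matching (n + 1)) : Prop :=
  x ∈ Finset.Icc 2 (2 * n + 2) ∧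
    N.edges = insert {1, x} (M.edges.image fun B => B.image (relabel x))

lemma isChild_iff : IsChild M N ↔ ∃ x, IsChildAt M x N := Iff.rfl

lemma exists_isChildAt (M : Matching n) (hx : x ∈ Finset.Icc 2 (2 * n + 2)) :
    ∃ N, IsChildAt M x N := by
  have hx' := Finset.mem_Icc.1 hx
  suffices h : ∃ N : Matching (n + 1),
      N.edges = insert {1, x} (M.edges.image fun B => B.image (relabel x)) from
    h.imp fun N hN => ⟨hx, hN⟩
  refine exists_matching_of_edges _ ?_ ?_ ?_ ?_
  · simp only [Finset.mem_insert, Finset.mem_image]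
    rintro B (rfl | ⟨B, hB, rfl⟩)
    · exact Finset.card_pair (by omega)
    · rw [Finset.card_image_of_injective _ (relabel_strictMono x).injective, card_edge hB]
  · simp only [Finset.mem_insert, Finset.mem_image]
    rintro B (rfl | ⟨B, hB, rfl⟩) v hv
    · simp only [Finset.mem_insert, Finset.mem_singleton] at hv
      rw [Finset.mem_Icc]; omega
    · obtain ⟨k, hk, rfl⟩ := Finset.mem_image.1 hv
      have h1 := Finset.mem_Icc.1 (edge_subset hB hk)
      have h2 := relabel_le_add_two x k
      have h3 := add_one_le_relabel x k
      rw [Finset.mem_Icc]; omega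
  · have key : ∀ B ∈ M.edges, ∀ v ∈ ({1, x} : Finset ℕ), v ∉ B.image (relabel x) := by
      intro B hB v hv
      simp only [Finset.mem_insert, Finset.mem_singleton] at hv
      rcases hv with rfl | rfl
      · exact one_notMem_image_relabel hB
      · exact notMem_image_relabel
    simp only [Finset.mem_insert, Finset.mem_image]
    rintro B (rfl | ⟨B, hB, rfl⟩) B' (rfl | ⟨B', hB', rfl⟩) v hv hv'
    · rfl
    · exact absurd hv' (key B' hB' v hv)
    · exact absurd hv (key B hB v hv')
    · obtain ⟨k, hk, rfl⟩ := Finset.mem_image.1 hv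
      obtain ⟨k', hk', e⟩ := Finset.mem_image.1 hv'
      rw [(relabel_strictMono x).injective e] at hk'
      rw [eq_of_mem_edges hB hB' hk hk']
  · intro v hv
    by_cases h1 : v = 1
    · exact ⟨{1, x}, by simp, by simp [h1]⟩
    by_cases hvx : v = x
    · exact ⟨{1, x}, by simp, by simp [hvx]⟩
    obtain ⟨k, hk, rfl⟩ := exists_relabel_eq (m := 2 * n) hx hv h1 hvx
    obtain ⟨B, hB, hkB⟩ := M.exists_edge_mem hk
    exact ⟨B.image (relabel x), Finset.mem_insert_of_mem (Finset.mem_image_of_mem _ hB),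
      Finset.mem_image_of_mem _ hkB⟩

namespace IsChildAt

lemma pair_notMem_image (x : ℕ) :
    {1, x} ∉ M.edges.image fun B => B.image (relabel x) := by
  intro h
  obtain ⟨B, hB, e⟩ := Finset.mem_image.1 h
  exact one_notMem_image_relabel (x := x) hB (by simp only [e]; simp)

lemma eq_position (h : IsChildAt M x N) (h' : IsChildAt M' x' N) : x = x' := by
  have h1 : ({1, x} : Finset ℕ) ∈ N.edges := by rw [h.2]; simp
  have h2 : ({1, x'} : Finset ℕ) ∈ N.edges := by rw [h'.2]; simp
  have h3 := eq_of_mem_edges h1 h2 (v := 1) (by simp) (by simp)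
  have h4 : x ∈ ({1, x'} : Finset ℕ) := by rw [← h3]; simp
  have h5 := Finset.mem_Icc.1 h.1
  simp only [Finset.mem_insert, Finset.mem_singleton] at h4
  omega

/-- The edge at vertex 1 determines `x`, and erasing it leaves an injective image of the parent.
Hence distinct matchings have no common child. -/
lemma eq_parent (h : IsChildAt M x N) (h' : IsChildAt M' x' N) : M = M' := by
  obtain rfl := h.eq_position h'
  have e := h.2.symm.trans h'.2
  have e2 := congrArg (fun E => E.erase ({1, x} : Finset ℕ)) e
  simp only [Finset.erase_insert (pair_notMem_image x)] at e2
  exact ext_edges (Finset.image_injective (image_relabel_injective x) e2)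

lemma eq_child {N' : Matching (n + 1)} (h : IsChildAt M x N) (h' : IsChildAt M x N') : N = N' :=
  ext_edges (h.2.trans h'.2.symm)

end IsChildAt

lemma exists_parent (N : Matching (n + 1)) : ∃ (M : Matching n) (x : ℕ), IsChildAt M x N := by
  obtain ⟨A, hA, h1A⟩ := N.exists_edge_mem (v := 1) (by rw [Finset.mem_Icc]; omega)
  obtain ⟨x, hx1, rfl⟩ : ∃ x, x ≠ 1 ∧ A = {1, x} := by
    obtain ⟨a, b, hab, rfl⟩ := Finset.card_eq_two.1 (card_edge hA)
    simp only [Finset.mem_insert, Finset.mem_singleton] at h1A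
    rcases h1A with rfl | rfl
    · exact ⟨b, hab.symm, rfl⟩
    · exact ⟨a, hab, Finset.pair_comm _ _⟩
  have hx : x ∈ Finset.Icc 2 (2 * n + 2) := by
    have := Finset.mem_Icc.1 (edge_subset hA (show x ∈ {1, x} by simp))
    rw [Finset.mem_Icc]; omega
  -- The other edges avoid 1 and `x`, hence lie in the range of the relabelling.
  have key : ∀ C ∈ N.edges, C ≠ {1, x} → ∃ B ⊆ Finset.Icc 1 (2 * n), B.image (relabel x) = C := by
    intro C hC hne
    have hC1 : 1 ∉ C := fun h => hne (eq_of_mem_edges hC hA h (by simp))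
    have hCx : x ∉ C := fun h => hne (eq_of_mem_edges hC hA h (by simp))
    refine ⟨(Finset.Icc 1 (2 * n)).filter fun k => relabel x k ∈ C, Finset.filter_subset _ _, ?_⟩
    ext v
    simp only [Finset.mem_image, Finset.mem_filter]
    constructor
    · rintro ⟨k, ⟨-, hk⟩, rfl⟩
      exact hk
    · intro hv
      obtain ⟨k, hk, rfl⟩ := exists_relabel_eq (m := 2 * n) hx (edge_subset hC hv)
        (fun h => hC1 (h ▸ hv)) (fun h => hCx (h ▸ hv))
      exact ⟨k, ⟨hk, hv⟩, rfl⟩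
  suffices h : ∃ M : Matching n, M.edges =
      (Finset.Icc 1 (2 * n)).powerset.filter fun B => B.image (relabel x) ∈ N.edges by
    obtain ⟨M, hM⟩ := h
    refine ⟨M, x, hx, ?_⟩
    rw [hM]
    ext C
    simp only [Finset.mem_insert, Finset.mem_image, Finset.mem_filter, Finset.mem_powerset]
    constructor
    · intro hC
      by_cases hne : C = {1, x}
      · exact Or.inl hne
      · obtain ⟨B, hB, rfl⟩ := key C hC hne
        exact Or.inr ⟨B, ⟨hB, hC⟩, rfl⟩
    · rintro (rfl | ⟨B, ⟨-, hB⟩, rfl⟩)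
      · exact hA
      · exact hB
  refine exists_matching_of_edges _ ?_ ?_ ?_ ?_
  · intro B hB
    rw [← card_edge (Finset.mem_filter.1 hB).2,
      Finset.card_image_of_injective _ (relabel_strictMono x).injective]
  · intro B hB
    exact Finset.mem_powerset.1 (Finset.mem_filter.1 hB).1
  · intro B hB B' hB' v hv hv'
    exact image_relabel_injective x (eq_of_mem_edges (Finset.mem_filter.1 hB).2
      (Finset.mem_filter.1 hB').2 (Finset.mem_image_of_mem _ hv) (Finset.mem_image_of_mem _ hv'))
  · intro u hu
    have hu' := Finset.mem_Icc.1 hu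
    have h2 := relabel_le_add_two x u
    have h3 := add_one_le_relabel x u
    obtain ⟨C, hC, hvC⟩ := N.exists_edge_mem (v := relabel x u) (by rw [Finset.mem_Icc]; omega)
    have hne : C ≠ {1, x} := by
      rintro rfl
      have := relabel_ne x u
      simp only [Finset.mem_insert, Finset.mem_singleton] at hvC
      omega
    obtain ⟨B, hB, rfl⟩ := key C hC hne
    obtain ⟨k, hk, e⟩ := Finset.mem_image.1 hvC
    rw [(relabel_strictMono x).injective e] at hk
    exact ⟨B, Finset.mem_filter.2 ⟨Finset.mem_powerset.2 hB, hC⟩, hk⟩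

/-! ### The Dyck path of a matching, and how path and nestings change in a child. -/

/-- The vertex `v` is the larger vertex of its edge. -/
def IsCloser (M : Matching n) (v : ℕ) : Prop := ∃ B ∈ M.edges, v ∈ B ∧ ∃ a ∈ B, a < v

instance (M : Matching n) (v : ℕ) : Decidable (M.IsCloser v) := by
  unfold IsCloser; infer_instance

/-- The type of a vertex: a down-step for the larger vertex of an edge, an up-step otherwise. -/
def stepAt (M : Matching n) (v : ℕ) : DyckStep :=
  if M.IsCloser v then DyckStep.D else DyckStep.U

/-- The Dyck path of a matching as a word. -/
def word (M : Matching n) : List DyckStep := (List.range' 1 (2 * n)).map M.stepAt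

@[simp] lemma length_word (M : Matching n) : M.word.length = 2 * n := by simp [word]

namespace IsChildAt

lemma isCloser_iff (h : IsChildAt M x N) {v : ℕ} :
    N.IsCloser v ↔ v = x ∨ ∃ u, relabel x u = v ∧ M.IsCloser u := by
  have hx := Finset.mem_Icc.1 h.1
  simp only [IsCloser, h.2, Finset.mem_insert, Finset.mem_image]
  constructor
  · rintro ⟨B, rfl | ⟨B, hB, rfl⟩, hv, a, ha, hav⟩
    · simp only [Finset.mem_insert, Finset.mem_singleton] at hv ha
      omega
    · obtain ⟨u, hu, rfl⟩ := Finset.mem_image.1 hv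
      obtain ⟨b, hb, rfl⟩ := Finset.mem_image.1 ha
      exact Or.inr ⟨u, rfl, B, hB, hu, b, hb, (relabel_strictMono x).lt_iff_lt.1 hav⟩
  · rintro (rfl | ⟨u, rfl, B, hB, hu, b, hb, hbu⟩)
    · exact ⟨_, Or.inl rfl, by simp, 1, by simp, by omega⟩
    · exact ⟨_, Or.inr ⟨B, hB, rfl⟩, Finset.mem_image_of_mem _ hu, _, Finset.mem_image_of_mem _ hb,
        relabel_strictMono x hbu⟩

lemma stepAt_relabel (h : IsChildAt M x N) (u : ℕ) : N.stepAt (relabel x u) = M.stepAt u := by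
  have : N.IsCloser (relabel x u) ↔ M.IsCloser u := by
    rw [h.isCloser_iff]
    constructor
    · rintro (e | ⟨k, hk, hM⟩)
      · exact absurd e (relabel_ne x u)
      · rwa [← (relabel_strictMono x).injective hk]
    · exact fun hM => Or.inr ⟨u, rfl, hM⟩
  simp only [stepAt, this]

/-- Relabelling preserves the type of every old vertex, and `x - 2` old vertices precede `x`, since
vertex 1 is new. -/
lemma word_eq (h : IsChildAt M x N) : N.word = insertArc M.word (x - 2) := by
  have hx := Finset.mem_Icc.1 h.1
  obtain ⟨j, rfl⟩ : ∃ j, x = j + 2 := ⟨x - 2, by omega⟩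
  obtain ⟨m, hm⟩ : ∃ m, 2 * n = j + m := ⟨2 * n - j, by omega⟩
  have h1 : N.stepAt 1 = DyckStep.U := by
    rw [stepAt, if_neg]
    rintro ⟨B, hB, -, a, ha, ha1⟩
    have := one_le_of_mem_edge hB ha
    omega
  have h2 : N.stepAt (j + 2) = DyckStep.D := by
    rw [stepAt, if_pos (h.isCloser_iff.2 (Or.inl rfl))]
  have e1 : M.word = (List.range' 1 j).map M.stepAt ++ (List.range' (j + 1) m).map M.stepAt := by
    rw [word, hm, ← List.map_append, add_comm j 1, List.range'_append_1]
  have e2 : List.range' 1 (2 * (n + 1)) =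
      1 :: (List.range' 2 j ++ (j + 2) :: List.range' (j + 3) m) := by
    rw [show 2 * (n + 1) = (j + (m + 1)) + 1 by omega, List.range'_succ,
      ← List.range'_append_1, List.range'_succ, add_comm 2 j]
  have e3 : List.range' 2 j = (List.range' 1 j).map (relabel (j + 2)) := by
    rw [show List.range' 2 j = (List.range' 1 j).map (fun k => 1 + k) by
      rw [List.map_add_range']]
    refine List.map_congr_left fun k hk => ?_
    rw [List.mem_range'_1] at hk
    rw [relabel, if_pos (by omega), add_comm]
  have e4 : List.range' (j + 3) m = (List.range' (j + 1) m).map (relabel (j + 2)) := by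
    rw [show List.range' (j + 3) m = (List.range' (j + 1) m).map (fun k => 2 + k) by
      rw [List.map_add_range']; congr 1; ring]
    refine List.map_congr_left fun k hk => ?_
    rw [List.mem_range'_1] at hk
    rw [relabel, if_neg (by omega), add_comm]
  have e5 : N.stepAt ∘ relabel (j + 2) = M.stepAt := funext h.stepAt_relabel
  rw [insertArc, e1, Nat.add_sub_cancel, List.take_left' (by simp), List.drop_left' (by simp), word,
    e2, List.map_cons, List.map_append, List.map_cons, h1, h2, e3, e4, List.map_map, List.map_map,
    e5]

end IsChildAt

lemma exists_edge_eq_pair {B : Finset ℕ} (hB : B ∈ M.edges) : ∃ a b, a < b ∧ B = {a, b} := by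
  obtain ⟨a, b, hab, rfl⟩ := Finset.card_eq_two.1 (card_edge hB)
  rcases lt_or_gt_of_ne hab with h | h
  · exact ⟨a, b, h, rfl⟩
  · exact ⟨b, a, h, Finset.pair_comm _ _⟩

/-- Each down-step corresponds to the edge of which it is the maximum. -/
lemma count_take_word (M : Matching n) {j : ℕ} (hj : j ≤ 2 * n) :
    (M.word.take j).count DyckStep.D = (M.edges.filter fun B => ∀ b ∈ B, b ≤ j).card := by
  have h1 : (M.word.take j).count DyckStep.D = ((Finset.Icc 1 j).filter M.IsCloser).card := by
    have hr : List.range' 1 (2 * n) = List.range' 1 j ++ List.range' (1 + j) (2 * n - j) := by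
      rw [List.range'_append_1, Nat.add_sub_cancel' hj]
    rw [word, ← List.map_take, hr, List.take_left' (by simp), List.count, List.countP_map]
    rw [Finset.card_def, Finset.filter_val, ← Multiset.countP_eq_card_filter]
    -- Unfolds `Finset.Icc 1 j` to the list that underlies it.
    change _ = Multiset.countP _ (List.range' 1 (j + 1 - 1) : Multiset ℕ)
    rw [Multiset.coe_countP, Nat.add_sub_cancel]
    refine List.countP_congr fun v _ => ?_
    simp only [Function.comp_apply, stepAt]
    split_ifs with h <;> simp [h]
  rw [h1]
  symm
  refine Finset.card_nbij (fun B => B.sup id) ?_ ?_ ?_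
  · intro B hB
    simp only [Finset.coe_filter, Set.mem_ofPred_eq] at hB ⊢
    obtain ⟨a, b, hab, rfl⟩ := exists_edge_eq_pair hB.1
    have e : ({a, b} : Finset ℕ).sup id = b := by simp [hab.le]
    have := hB.2 b (by simp)
    rw [e, Finset.mem_Icc]
    exact ⟨⟨one_le_of_mem_edge hB.1 (by simp), this⟩, _, hB.1, by simp, a, by simp, hab⟩
  · intro B hB B' hB' e
    simp only [Finset.coe_filter, Set.mem_ofPred_eq] at hB hB' e
    obtain ⟨a, b, hab, rfl⟩ := exists_edge_eq_pair hB.1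
    obtain ⟨a', b', hab', rfl⟩ := exists_edge_eq_pair hB'.1
    have e1 : b = b' := by simpa [hab.le, hab'.le] using e
    exact eq_of_mem_edges hB.1 hB'.1 (v := b) (by simp) (by simp [e1])
  · intro v hv
    simp only [Finset.coe_filter, Set.mem_ofPred_eq, Finset.mem_Icc] at hv
    obtain ⟨⟨-, hvj⟩, B, hB, hvB, c, hc, hcv⟩ := hv
    obtain ⟨a, b, hab, rfl⟩ := exists_edge_eq_pair hB
    simp only [Finset.mem_insert, Finset.mem_singleton] at hvB hc
    obtain rfl : v = b := by omega
    refine ⟨_, ?_, show ({a, v} : Finset ℕ).sup id = v by simp [hab.le]⟩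
    simp only [Finset.coe_filter, Set.mem_ofPred_eq, Finset.mem_insert, Finset.mem_singleton]
    exact ⟨hB, by rintro b (rfl | rfl) <;> omega⟩

lemma nests_image_relabel {A B : Finset ℕ} :
    Nests (A.image (relabel x)) (B.image (relabel x)) ↔ Nests A B := by
  simp only [Nests, Finset.exists_mem_image, (relabel_strictMono x).lt_iff_lt]

namespace IsChildAt

/-- Nestings among old edges persist. The new edge contains the least vertex, so it is never the
inner one; it is the outer one for the old edges with both vertices at most `x - 2`. -/
lemma ne_eq (h : IsChildAt M x N) :
    N.ne = M.ne + (M.word.take (x - 2)).count DyckStep.D := by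
  have hx := Finset.mem_Icc.1 h.1
  have hnot : ∀ A ∈ insert {1, x} (M.edges.image fun B => B.image (relabel x)),
      ¬ Nests A {1, x} := by
    rw [← h.2]
    rintro A hA ⟨a, ha, d, hd, b, hb, c, hc, h1, h2, h3⟩
    have := one_le_of_mem_edge hA ha
    simp only [Finset.mem_insert, Finset.mem_singleton] at hb hc
    omega
  have hnew : ∀ B ∈ M.edges, Nests {1, x} (B.image (relabel x)) ↔ ∀ b ∈ B, b ≤ x - 2 := by
    intro B hB
    obtain ⟨a, b, hab, rfl⟩ := exists_edge_eq_pair hB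
    have ha := one_le_of_mem_edge hB (v := a) (by simp)
    constructor
    · rintro ⟨p, hp, s, hs, q', hq', r', hr', h1, h2, h3⟩
      obtain ⟨q, hq, rfl⟩ := Finset.mem_image.1 hq'
      obtain ⟨r, hr, rfl⟩ := Finset.mem_image.1 hr'
      have h2' := (relabel_strictMono x).lt_iff_lt.1 h2
      have h4 := add_one_le_relabel x r
      simp only [Finset.mem_insert, Finset.mem_singleton] at hp hs hq hr
      obtain rfl : s = x := by omega
      have h5 := (relabel_lt_iff s r).1 h3
      have h6 : r = b := by
        rcases hr with rfl | rfl
        · rcases hq with rfl | rfl <;> omega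
        · rfl
      intro c hc
      simp only [Finset.mem_insert, Finset.mem_singleton] at hc
      omega
    · intro hb
      have h1 := hb b (by simp)
      have h2 := add_one_le_relabel x a
      exact ⟨1, by simp, x, by simp, relabel x a, by simp, relabel x b, by simp, by omega,
        relabel_strictMono x hab, (relabel_lt_iff x b).2 (by omega)⟩
  have e1 : ∀ E : Finset (Finset ℕ), ((E ×ˢ E).filter fun p => Nests p.1 p.2).card =
      ∑ A ∈ E, ∑ B ∈ E, if Nests A B then 1 else 0 := by
    intro E
    rw [Finset.card_filter, Finset.sum_product]
  have hinj := (image_relabel_injective x).injOn (s := (M.edges : Set (Finset ℕ)))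
  rw [M.count_take_word (by omega), ne, ne, e1, e1, h.2,
    Finset.sum_insert (pair_notMem_image x), Finset.sum_insert (pair_notMem_image x),
    if_neg (hnot _ (Finset.mem_insert_self _ _)), zero_add, add_comm]
  congr 1
  · rw [Finset.sum_image hinj]
    refine Finset.sum_congr rfl fun A hA => ?_
    rw [Finset.sum_insert (pair_notMem_image x),
      if_neg (hnot _ (Finset.mem_insert_of_mem (Finset.mem_image_of_mem _ hA))), zero_add,
      Finset.sum_image hinj]
    simp only [nests_image_relabel]
  · rw [Finset.sum_image hinj, Finset.card_filter]
    exact Finset.sum_congr rfl fun B hB => by simp only [hnew B hB]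

end IsChildAt

end Matching

/-! ### Profiles and nesting-similarity. -/

namespace Matching

variable {n : ℕ} {M M' : Matching n} {N : Matching (n + 1)}

/-- The Dyck path of a matching together with its number of nestings. -/
def profile (M : Matching n) : List DyckStep × ℕ := (M.word, M.ne)

/-- The profiles of the children of a matching, in terms of its own profile. -/
def childProfiles (d : List DyckStep × ℕ) : Multiset (List DyckStep × ℕ) :=
  (Multiset.range (d.1.length + 1)).map fun j =>
    (insertArc d.1 j, d.2 + (d.1.take j).count DyckStep.D)

lemma IsChildAt.profile_eq {x : ℕ} (h : IsChildAt M x N) :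
    N.profile = (insertArc M.word (x - 2), M.ne + (M.word.take (x - 2)).count DyckStep.D) :=
  Prod.ext h.word_eq h.ne_eq

/-- The bound on `j` is kept inside the existential so that `child` is total, with an arbitrary
value for larger `j`. -/
lemma exists_child (M : Matching n) (j : ℕ) : ∃ N, j ≤ 2 * n → IsChildAt M (j + 2) N := by
  by_cases hj : j ≤ 2 * n
  · obtain ⟨N, hN⟩ := M.exists_isChildAt (x := j + 2) (Finset.mem_Icc.2 ⟨by omega, by omega⟩)
    exact ⟨N, fun _ => hN⟩
  · obtain ⟨N, -⟩ := M.exists_isChildAt (x := 2) (Finset.mem_Icc.2 ⟨by omega, by omega⟩)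
    exact ⟨N, fun h => absurd h hj⟩

/-- The child of `M` whose first edge ends after the first `j` vertices of `M`. -/
noncomputable def child (M : Matching n) (j : ℕ) : Matching (n + 1) := (M.exists_child j).choose

lemma isChildAt_child (M : Matching n) {j : ℕ} (hj : j ≤ 2 * n) : IsChildAt M (j + 2) (M.child j) :=
  (M.exists_child j).choose_spec hj

open Classical in
/-- The finset of children of a matching. -/
noncomputable def children (M : Matching n) : Finset (Matching (n + 1)) :=
  (Finset.range (2 * n + 1)).image M.child

lemma mem_children : N ∈ M.children ↔ IsChild M N := by
  classical
  simp only [children, Finset.mem_image, Finset.mem_range, isChild_iff]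
  constructor
  · rintro ⟨j, hj, rfl⟩
    exact ⟨_, M.isChildAt_child (by omega)⟩
  · rintro ⟨x, hx⟩
    have hx' := Finset.mem_Icc.1 hx.1
    obtain ⟨j, rfl⟩ : ∃ j, x = j + 2 := ⟨x - 2, by omega⟩
    exact ⟨j, by omega, (M.isChildAt_child (by omega)).eq_child hx⟩

lemma map_profile_children (M : Matching n) :
    M.children.val.map profile = childProfiles M.profile := by
  classical
  have hinj : Set.InjOn M.child (Finset.range (2 * n + 1)) := by
    intro i hi j hj e
    simp only [Finset.coe_range, Set.mem_Iio] at hi hj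
    have h1 := M.isChildAt_child (j := i) (by omega)
    rw [e] at h1
    have := h1.eq_position (M.isChildAt_child (j := j) (by omega))
    omega
  rw [children, Finset.image_val_of_injOn hinj, Multiset.map_map, childProfiles]
  simp only [profile, length_word]
  refine Multiset.map_congr rfl fun j hj => ?_
  rw [Multiset.mem_range] at hj
  exact (M.isChildAt_child (j := j) (by omega)).profile_eq

/-- The multiset of profiles of the matchings on the `l`-th level below `M`. -/
noncomputable def profileLevel (M : Matching n) (l : ℕ) : Multiset (List DyckStep × ℕ) :=
  (Set.toFinite (level M l)).toFinset.val.map profile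

lemma neLevel_eq_map (M : Matching n) (l : ℕ) : neLevel M l = (profileLevel M l).map Prod.snd := by
  rw [profileLevel, Multiset.map_map]
  rfl

lemma profileLevel_zero (M : Matching n) : profileLevel M 0 = {M.profile} := by
  have : (Set.toFinite (level M 0)).toFinset = {M} := by
    ext N
    simp [level]
  rw [profileLevel, this]
  rfl

/-- Levels are sets, but families of children of distinct matchings are disjoint, so no multiplicity
is lost. -/
lemma profileLevel_succ (M : Matching n) (l : ℕ) :
    profileLevel M (l + 1) = (profileLevel M l).bind childProfiles := by
  have hdisj : ((Set.toFinite (level M l)).toFinset : Set (Matching (n + l))).PairwiseDisjoint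
      children := by
    intro A _ B _ hAB
    refine Finset.disjoint_left.2 fun N hA hB => hAB ?_
    rw [mem_children, isChild_iff] at hA hB
    obtain ⟨x, hx⟩ := hA
    obtain ⟨y, hy⟩ := hB
    exact hx.eq_parent hy
  have h : (Set.toFinite (level M (l + 1))).toFinset =
      (Set.toFinite (level M l)).toFinset.disjiUnion children hdisj := by
    ext N
    simp only [Set.Finite.mem_toFinset, Finset.mem_disjiUnion, mem_children]
    rfl
  rw [profileLevel, h, Finset.disjiUnion_val]
  change Multiset.map profile (Multiset.bind _ _) = _
  rw [Multiset.map_bind, profileLevel, Multiset.bind_map]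
  exact Multiset.bind_congr fun A _ => map_profile_children A

/-- Levels 0 and 1 already recover the profile; conversely each level of profiles is computed from
the preceding one. -/
lemma nestingSimilarity_eq_ker (n : ℕ) :
    nestingSimilarity n = Setoid.ker (profile : Matching n → List DyckStep × ℕ) := by
  refine Setoid.ext fun M M' => ?_
  rw [Setoid.ker_def]
  constructor
  · intro h
    have h0 : neLevel M 0 = neLevel M' 0 := h 0
    have h1 : neLevel M 1 = neLevel M' 1 := h 1
    rw [neLevel_eq_map, neLevel_eq_map, profileLevel_zero, profileLevel_zero,
      Multiset.map_singleton, Multiset.map_singleton, Multiset.singleton_inj] at h0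
    rw [neLevel_eq_map, neLevel_eq_map, profileLevel_succ, profileLevel_succ, profileLevel_zero,
      profileLevel_zero, Multiset.singleton_bind, Multiset.singleton_bind, childProfiles,
      childProfiles, Multiset.map_map, Multiset.map_map] at h1
    refine Prod.ext (eq_of_map_count_take_eq (by simp [profile]) M.profile.2 ?_) h0
    conv_rhs => rw [h0]
    exact h1
  · intro h l
    have key : profileLevel M l = profileLevel M' l := by
      induction l with
      | zero => rw [profileLevel_zero, profileLevel_zero, h]
      | succ l ih => rw [profileLevel_succ, profileLevel_succ, ih]
    rw [neLevel_eq_map, neLevel_eq_map, key]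

/-! ### The set of attained profiles and its cardinality. -/

lemma edges_eq_empty (M : Matching 0) : M.edges = ∅ := by
  refine Finset.eq_empty_of_forall_notMem fun B hB => ?_
  have h1 := edge_subset hB
  have h2 := card_edge hB
  have h3 : B = ∅ := Finset.subset_empty.1 (by simpa using! h1)
  simp [h3] at h2

lemma ne_eq_zero (M : Matching 0) : M.ne = 0 := by simp [ne, edges_eq_empty]

lemma word_eq_nil (M : Matching 0) : M.word = [] := rfl

lemma word_isDyck_and_ne_le (M : Matching n) : StaysNonneg 0 M.word ∧ pathHeight M.word = 0 ∧
    (M.ne : ℤ) ≤ coverWeight 0 M.word := by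
  induction n with
  | zero => simp [word_eq_nil, ne_eq_zero, StaysNonneg, coverWeight]
  | succ n ih =>
    obtain ⟨M', x, h⟩ := M.exists_parent
    obtain ⟨h1, h2, h3⟩ := ih M'
    rw [h.word_eq, h.ne_eq, pathHeight_insertArc, coverWeight_insertArc]
    refine ⟨h1.insertArc _, h2, ?_⟩
    -- The altitude at the insertion point is the excess of the growth of the cover weight over that
    -- of `ne`.
    have := staysNonneg_iff.1 h1 (x - 2)
    push_cast
    linarith

lemma exists_profile_eq {w : List DyckStep} (hlen : w.length = 2 * n) (hw : StaysNonneg 0 w)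
    (hend : pathHeight w = 0) {k : ℕ} (hk : (k : ℤ) ≤ coverWeight 0 w) :
    ∃ M : Matching n, M.profile = (w, k) := by
  induction n generalizing w k with
  | zero =>
    obtain ⟨M, -⟩ := exists_matching_of_edges (n := 0) ∅ (by simp) (by simp) (by simp) (by simp)
    obtain rfl := List.length_eq_zero_iff.1 hlen
    have hk0 : k = 0 := by simpa [coverWeight] using hk
    exact ⟨M, Prod.ext M.word_eq_nil (M.ne_eq_zero.trans hk0.symm)⟩
  | succ n ih =>
    obtain ⟨w', j, k', hj, rfl, rfl, hw', hk'⟩ := hw.exists_insertArc hend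
      (by rintro rfl; simp at hlen) hk
    have hlen' : w'.length = 2 * n := by
      simp only [insertArc, List.length_cons, List.length_append, List.length_take,
        List.length_drop] at hlen
      omega
    obtain ⟨M, hM⟩ := ih hlen' hw' (by rwa [pathHeight_insertArc] at hend) hk'
    obtain ⟨rfl, rfl⟩ := Prod.ext_iff.1 hM
    exact ⟨M.child j, (M.isChildAt_child (by omega)).profile_eq⟩

/-- The Dyck words of semilength `n` with a number that is at most their number of covering pairs
of tunnels, as profiles. -/
def toProfile (n : ℕ) (q : Σ p : {p : DyckWord // p.semilength = n},
    Fin (1 + p.1.numCoveringPairs)) : List DyckStep × ℕ :=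
  (q.1.1.toList, q.2)

lemma toProfile_injective (n : ℕ) : Function.Injective (toProfile n) := by
  rintro ⟨⟨p, hp⟩, i⟩ ⟨⟨q, hq⟩, j⟩ h
  obtain ⟨h1, h2⟩ := Prod.ext_iff.1 h
  obtain rfl : p = q := DyckWord.ext h1
  obtain rfl : i = j := Fin.ext h2
  rfl

lemma range_toProfile (n : ℕ) :
    Set.range (toProfile n) = Set.range (profile : Matching n → List DyckStep × ℕ) := by
  ext d
  constructor
  · rintro ⟨⟨⟨p, hp⟩, k, hk⟩, rfl⟩
    refine exists_profile_eq (by rw [← p.two_mul_semilength_eq_length, hp]) p.staysNonneg_toList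
      p.pathHeight_toList ?_
    have : (k : ℤ) ≤ p.numCoveringPairs := by simp only at hk; omega
    rwa [p.numCoveringPairs_eq] at this
  · rintro ⟨M, rfl⟩
    obtain ⟨h1, h2, h3⟩ := M.word_isDyck_and_ne_le
    let p : DyckWord := ⟨M.word, by rw [pathHeight] at h2; omega, fun i => by
      have := staysNonneg_iff.1 h1 i
      rw [pathHeight] at this; omega⟩
    have hp : p.semilength = n := by
      have h4 : 2 * p.semilength = M.word.length := p.two_mul_semilength_eq_length
      rw [length_word] at h4; omega
    have h5 : (p.numCoveringPairs : ℤ) = coverWeight 0 M.word := p.numCoveringPairs_eq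
    exact ⟨⟨⟨p, hp⟩, M.ne, by simp only; omega⟩, rfl⟩

lemma card_quotient_nestingSimilarity (n : ℕ) : Nat.card (Quotient (nestingSimilarity n)) =
    ∑ p : {p : DyckWord // p.semilength = n}, (1 + p.1.numCoveringPairs) := by
  rw [nestingSimilarity_eq_ker, Nat.card_congr (Setoid.quotientKerEquivRange _), ← range_toProfile,
    Nat.card_range_of_injective (toProfile_injective n), Nat.card_eq_fintype_card,
    Fintype.card_sigma]
  simp only [Fintype.card_fin]

end Matching

theorem mainTheorem5 (n : ℕ) (hn : 1 ≤ n) :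
    (Nat.card (Quotient (Matching.nestingSimilarity n)) : ℚ) =
        2 * 4 ^ (n - 1) - (3 * (n : ℚ) - 1) / (2 * (n : ℚ) + 2) * ((2 * n).choose n : ℚ) ∧
      Nat.card (Quotient (Matching.nestingSimilarity n)) =
        ∑ p : {p : DyckWord // p.semilength = n}, (1 + p.1.numCoveringPairs) := by
  have h := Matching.card_quotient_nestingSimilarity n
  refine ⟨?_, h⟩
  have h2 : ((∑ p : {p : DyckWord // p.semilength = n}, (1 + p.1.numCoveringPairs) : ℕ) : ℤ) =
      catalan n + DyckWord.totalCoverWeight n := by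
    rw [← DyckWord.sum_coverWeight, ← DyckWord.card_dyckWord_semilength_eq_catalan]
    push_cast
    rw [Finset.sum_add_distrib]
    simp [DyckWord.numCoveringPairs_eq]
  rw [← DyckWord.catalan_add_totalCoverWeight n hn, h]
  exact_mod_cast h2
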